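/- Let $G=(U,V,E)$ be a finite bipartite graph with edge weights $w:E\to\mathbb{Q}$, $w_e>0$ for all $e\in E$. In the assignment game on $G$ the agents are the vertices $U\cup V$, and the worth $c(S)$ of a coalition $S\subseteq U\cup V$ is the maximum weight of a matching in the subgraph of $G$ induced on $S$. A core imputation is a function $p:U\cup V\to\mathbb{Q}_{\ge 0}$ with $\sum_{q\in U\cup V}p(q)=c(U\cup V)$ and $\sum_{q\in S}p(q)\ge c(S)$ for every $S\subseteq U\cup V$. An agent is essential if it is matched in every maximum weight matching of $G$. A leximin core imputation is a core imputation for which the list of the profits $p(q)$ of the essential agents $q$, sorted in increasing order, is lexicographically largest among all core imputations. If all edge weights are integers, then there is exactly one leximin core imputation $p$, and it is half-integral, i.e. $2p(q)\in\mathbb{Z}$ for every $q\in U\cup V$. -/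

import Mathlib

/-- The data of an assignment game: a finite bipartite graph with sides `U` and `V`, given by its
set of edges, with positive rational edge weights (values of `weight` off `edges` are never used). -/
structure AssignmentGame (U V : Type*) where
  edges : Finset (U × V)
  weight : U × V → ℚ
  weight_pos : ∀ e ∈ edges, 0 < weight e

namespace AssignmentGame

variable {U V : Type*}

/-- `M` is a matching of the graph: a set of edges no two of which share an endpoint. -/
def IsMatching (G : AssignmentGame U V) (M : Finset (U × V)) : Prop :=
  M ⊆ G.edges ∧ ∀ e ∈ M, ∀ f ∈ M, (e.1 = f.1 ∨ e.2 = f.2) → e = f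

/-- The total weight of a set of edges. -/
def totalWeight (G : AssignmentGame U V) (M : Finset (U × V)) : ℚ := ∑ e ∈ M, G.weight e

/-- A maximum weight matching of the whole graph. -/
def IsMaxMatching (G : AssignmentGame U V) (M : Finset (U × V)) : Prop :=
  G.IsMatching M ∧ ∀ M', G.IsMatching M' → G.totalWeight M' ≤ G.totalWeight M

open Classical in
/-- The matchings of the graph restricted to the vertices of the sub-coalition `S`. -/
noncomputable def matchingsIn (G : AssignmentGame U V) (S : Finset (U ⊕ V)) :
    Finset (Finset (U × V)) :=
  G.edges.powerset.filter fun M =>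
    G.IsMatching M ∧ ∀ e ∈ M, Sum.inl e.1 ∈ S ∧ Sum.inr e.2 ∈ S

open Classical in
theorem matchingsIn_nonempty (G : AssignmentGame U V) (S : Finset (U ⊕ V)) :
    (G.matchingsIn S).Nonempty :=
  ⟨∅, Finset.mem_filter.2 ⟨Finset.empty_mem_powerset _, by simp [IsMatching], by simp⟩⟩

/-- The characteristic function of the game: the worth of the sub-coalition `S` is the weight of
a maximum weight matching in the graph restricted to `S`. -/
noncomputable def worth (G : AssignmentGame U V) (S : Finset (U ⊕ V)) : ℚ :=
  (G.matchingsIn S).sup' (G.matchingsIn_nonempty S) G.totalWeight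

/-- An imputation: a nonnegative division of the worth of the grand coalition among all agents.
The profit of `i : U` is `p (Sum.inl i)`, that of `j : V` is `p (Sum.inr j)`. -/
def IsImputation [Fintype U] [Fintype V] (G : AssignmentGame U V) (p : U ⊕ V → ℚ) : Prop :=
  (∀ q, 0 ≤ p q) ∧ ∑ q, p q = G.worth Finset.univ

/-- A core imputation: every sub-coalition gets at least its own worth. -/
def IsCoreImputation [Fintype U] [Fintype V] (G : AssignmentGame U V) (p : U ⊕ V → ℚ) : Prop :=
  G.IsImputation p ∧ ∀ S : Finset (U ⊕ V), G.worth S ≤ ∑ q ∈ S, p q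

/-- The agent `q` is an endpoint of an edge of `M`. -/
def IsMatchedIn (M : Finset (U × V)) (q : U ⊕ V) : Prop :=
  ∃ e ∈ M, Sum.inl e.1 = q ∨ Sum.inr e.2 = q

/-- An essential agent: one that is matched in every maximum weight matching. -/
def IsEssential (G : AssignmentGame U V) (q : U ⊕ V) : Prop :=
  ∀ M, G.IsMaxMatching M → IsMatchedIn M q

open Classical in
/-- The set of essential agents of both sides. -/
noncomputable def essentialAgents [Fintype U] [Fintype V] (G : AssignmentGame U V) :
    Finset (U ⊕ V) :=
  Finset.univ.filter fun q => G.IsEssential q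

/-- The profits of the essential agents (with repetitions), sorted in increasing order. -/
noncomputable def sortedProfits [Fintype U] [Fintype V] (G : AssignmentGame U V)
    (p : U ⊕ V → ℚ) : List ℚ :=
  (G.essentialAgents.val.map p).sort (· ≤ ·)

/-- A leximin core imputation: a core imputation whose sorted list of profits of essential agents
is lexicographically largest. (The order on `List ℚ` is the lexicographic one, and all the lists
compared have the same length, the number of essential agents.) -/
def IsLeximin [Fintype U] [Fintype V] (G : AssignmentGame U V) (p : U ⊕ V → ℚ) : Prop :=
  G.IsCoreImputation p ∧
    ∀ p', G.IsCoreImputation p' → G.sortedProfits p' ≤ G.sortedProfits p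

end AssignmentGame

/-! Relative to a fixed maximum weight matching, a core imputation is a nonnegative vertex cover of
the weights, tight on matched edges and zero at unmatched agents (`isCoreImputation_iff`). Suppose
its profits lie in `(1/N)ℤ`, `N` even, and are not all half-integral. Take the least offending
profit, raise its residue class mod 1 by `1/N` on its own side and lower the opposite class on the
other side. As the weights are integers, tight edges stay tight and slack edges stay covered; every
agent that moves had profit at least the least offending one, and those that drop stay above it. So
the sorted list improves (`exists_sortedProfits_lt`). Hence each core imputation is dominated by one
of the finitely many half-integral ones, which include an integral one by duality
(`exists_int_isCoreImputation`); the best of these is leximin. Averaging two distinct leximin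
imputations would improve one of them, whence uniqueness. -/

/-! ### Lexicographic comparison of sorted lists -/

/-- If the head of `l'` is at most `m`, it occurs in `l`, so the head of `l` is no larger: either it
is smaller, or both heads are removed. Otherwise all of `l'` lies above `m`, while `l` starts at or
below `m`. -/
theorem List.lt_of_subperm_filter {m : ℚ} : ∀ {l l' : List ℚ}, l.Pairwise (· ≤ ·) →
    l.length = l'.length → (l'.filter (· ≤ m)).Subperm (l.filter (· ≤ m)) →
    (l'.filter (· ≤ m)).length < (l.filter (· ≤ m)).length → l'.Pairwise (· ≤ ·) → l < l'
  | [], l', _, _, _, h, _ => by simp at h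
  | a :: t, [], _, h, _, _, _ => by simp at h
  | a :: t, b :: t', hs, hl, hp, hlt, hs' => by
    rw [List.pairwise_cons] at hs hs'
    by_cases hb : b ≤ m
    · have hbm : b ∈ (a :: t).filter (· ≤ m) := hp.subset (by simp [hb])
      have hab : a ≤ b := by
        rcases List.mem_cons.1 (List.mem_filter.1 hbm).1 with h | h
        · exact h.ge
        · exact hs.1 b h
      rcases hab.lt_or_eq with h | rfl
      · exact List.Lex.rel h
      · refine List.Lex.cons (List.lt_of_subperm_filter (m := m) hs.2 (by simpa using hl) ?_ ?_ hs'.2)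
        · simpa [List.filter_cons, hb, List.subperm_cons] using hp
        · simpa [List.filter_cons, hb] using hlt
    · have hnil : (b :: t').filter (· ≤ m) = [] := by
        rw [List.filter_eq_nil_iff]
        intro x hx
        rcases List.mem_cons.1 hx with rfl | h
        · simpa using hb
        · have := hs'.1 x h
          simp; linarith [not_le.1 hb]
      rw [hnil] at hlt
      obtain ⟨x, hx⟩ := List.exists_mem_of_length_pos hlt
      obtain ⟨hx, hxm⟩ := List.mem_filter.1 hx
      have hax : a ≤ x := by
        rcases List.mem_cons.1 hx with h | h
        · exact h.ge
        · exact hs.1 x h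
      have hxm : x ≤ m := by simpa using hxm
      exact List.Lex.rel (by linarith [not_le.1 hb])

/-- Sorted in increasing order, the values of `g` beat those of `f` lexicographically as soon as
every value of `g` up to `m` is also the value of `f`, and some value gets above `m`. -/
theorem Finset.sort_map_lt {α : Type*} (s : Finset α) (f g : α → ℚ) (m : ℚ)
    (h : ∀ a ∈ s, g a ≤ m → f a = g a) (h' : ∃ a ∈ s, f a ≤ m ∧ m < g a) :
    (s.val.map f).sort (· ≤ ·) < (s.val.map g).sort (· ≤ ·) := by
  classical
  have hc : ∀ u : α → ℚ, (((s.val.map u).sort (· ≤ ·)).filter (· ≤ m) : Multiset ℚ) =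
      (s.filter fun a => u a ≤ m).val.map u := by
    intro u
    rw [← Multiset.filter_coe, Multiset.sort_eq, Multiset.filter_map]
    simp
  have hsub : (s.filter fun a => g a ≤ m) ⊆ s.filter fun a => f a ≤ m := by
    intro a ha
    obtain ⟨ha, hm⟩ := Finset.mem_filter.1 ha
    exact Finset.mem_filter.2 ⟨ha, (h a ha hm).le.trans hm⟩
  refine List.lt_of_subperm_filter (m := m) (Multiset.pairwise_sort _ _) (by simp) ?_ ?_
    (Multiset.pairwise_sort _ _)
  · rw [← Multiset.coe_le, hc, hc]
    have hfg : (s.filter fun a => g a ≤ m).val.map g = (s.filter fun a => g a ≤ m).val.map f := by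
      refine Multiset.map_congr rfl fun a ha => ?_
      obtain ⟨ha, hm⟩ := Finset.mem_filter.1 (Finset.mem_def.2 ha)
      exact (h a ha hm).symm
    rw [hfg]
    exact Multiset.map_le_map (Finset.val_le_iff.2 hsub)
  · rw [← Multiset.coe_card, ← Multiset.coe_card, hc, hc, Multiset.card_map, Multiset.card_map]
    refine Finset.card_lt_card ⟨hsub, fun hs => ?_⟩
    obtain ⟨a, ha, hf, hg⟩ := h'
    exact absurd (Finset.mem_filter.1 (hs (Finset.mem_filter.2 ⟨ha, hf⟩))).2 (not_le.2 hg)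

/-! ### Integral duality by Hall's theorem -/

/-- Integral duality for the assignment problem on a square matrix with nonnegative entries. -/
theorem exists_perm_add_eq {ι : Type*} [Fintype ι] (w : ι → ι → ℤ) (hw : ∀ i j, 0 ≤ w i j) :
    ∃ (u v : ι → ℤ) (σ : Equiv.Perm ι), (∀ i, 0 ≤ u i) ∧ (∀ j, 0 ≤ v j) ∧
      (∀ i j, w i j ≤ u i + v j) ∧ ∀ i, u i + v (σ i) = w i (σ i) := by
  classical
  let cover : Set ((ι → ℤ) × (ι → ℤ)) := {x | ∀ i j, w i j ≤ x.1 i + x.2 j}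
  have hne : cover.Nonempty := by
    refine ⟨(fun i => ∑ j, w i j, 0), fun i j => ?_⟩
    simpa using Finset.single_le_sum (f := fun j => w i j) (fun j _ => hw i j) (Finset.mem_univ j)
  have hpos : ∀ x ∈ cover, 0 ≤ ∑ i, (x.1 i + x.2 i) := fun x hx =>
    Finset.sum_nonneg fun i _ => (hw i i).trans (hx i i)
  obtain ⟨⟨u, v⟩, huv, hmin⟩ : ∃ x ∈ cover, ∀ y ∈ cover,
      ∑ i, (x.1 i + x.2 i) ≤ ∑ i, (y.1 i + y.2 i) := by
    let f : (ι → ℤ) × (ι → ℤ) → ℕ := fun x => (∑ i, (x.1 i + x.2 i)).toNat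
    refine ⟨Function.argminOn f cover hne, Function.argminOn_mem f cover hne, fun y hy => ?_⟩
    have h1 := Function.argminOn_le f cover hy
    have h2 := hpos _ (Function.argminOn_mem f cover hne)
    have h3 := hpos y hy
    simp only [f] at h1 h2 ⊢
    omega
  -- Hall's condition for the tight pairs. If `S` had too few tight neighbours `T`, lowering `u` by
  -- one on `S` and raising `v` by one on `T` would give a cheaper cover, since non-tight pairs have
  -- integer slack at least one.
  have hall : ∀ S : Finset ι,
      S.card ≤ (Finset.univ.filter fun j => ∃ i ∈ S, u i + v j = w i j).card := by
    intro S
    by_contra! hlt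
    set T := Finset.univ.filter fun j => ∃ i ∈ S, u i + v j = w i j with hT
    have := hmin (fun i => u i - if i ∈ S then 1 else 0, fun j => v j + if j ∈ T then 1 else 0) ?_
    · simp only [Finset.sum_add_distrib, Finset.sum_sub_distrib, Finset.sum_boole,
        Finset.filter_mem_eq_inter, Finset.univ_inter] at this
      omega
    · intro i j
      have hij := huv i j
      by_cases hi : i ∈ S <;> by_cases hj : j ∈ T <;> simp only [hi, hj, if_true, if_false] at hij ⊢
      · linarith
      · have : u i + v j ≠ w i j := fun h => hj (by simpa [hT] using ⟨i, hi, h⟩)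
        omega
      · linarith
      · linarith
  obtain ⟨f, hf, hfw⟩ := (Fintype.all_card_le_filter_rel_iff_exists_injective
    fun i j => u i + v j = w i j).1 hall
  rcases isEmpty_or_nonempty ι with hι | hι
  · exact ⟨u, v, Equiv.refl _, fun i => hι.elim i, fun i => hι.elim i, huv, fun i => hι.elim i⟩
  -- Covers were not required to be nonnegative. Shifting so that the least `u` is zero repairs both
  -- signs, because `v j + u i₀ ≥ w i₀ j ≥ 0`.
  obtain ⟨i₀, hi₀⟩ := Finite.exists_min u
  refine ⟨fun i => u i - u i₀, fun j => v j + u i₀, Equiv.ofBijective f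
    (Finite.injective_iff_bijective.1 hf), fun i => sub_nonneg.2 (hi₀ i), fun j => ?_,
    fun i j => ?_, fun i => ?_⟩
  · have := (hw i₀ j).trans (huv i₀ j)
    simp only at this ⊢
    linarith
  · have := huv i j
    simp only at this ⊢
    linarith
  · have := hfw i
    simp only [Equiv.ofBijective_apply]
    linarith

/-! ### Core imputations and complementary slackness -/

namespace AssignmentGame

variable {U V : Type*} {G : AssignmentGame U V} {M : Finset (U × V)}

theorem totalWeight_le_worth {S : Finset (U ⊕ V)} (hM : G.IsMatching M)
    (hS : ∀ e ∈ M, Sum.inl e.1 ∈ S ∧ Sum.inr e.2 ∈ S) : G.totalWeight M ≤ G.worth S := by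
  classical
  exact Finset.le_sup' G.totalWeight
    (Finset.mem_filter.2 ⟨Finset.mem_powerset.2 hM.1, hM, hS⟩)

theorem exists_matching_worth (G : AssignmentGame U V) (S : Finset (U ⊕ V)) :
    ∃ M, G.IsMatching M ∧ (∀ e ∈ M, Sum.inl e.1 ∈ S ∧ Sum.inr e.2 ∈ S) ∧
      G.worth S = G.totalWeight M := by
  classical
  obtain ⟨M, hM, h⟩ := Finset.exists_mem_eq_sup' (G.matchingsIn_nonempty S) G.totalWeight
  exact ⟨M, (Finset.mem_filter.1 hM).2.1, (Finset.mem_filter.1 hM).2.2, h⟩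

variable [Fintype U] [Fintype V]

theorem IsMaxMatching.worth_univ (hM : G.IsMaxMatching M) :
    G.worth Finset.univ = G.totalWeight M := by
  obtain ⟨M', hM', -, h⟩ := G.exists_matching_worth Finset.univ
  exact le_antisymm (h ▸ hM.2 M' hM') (totalWeight_le_worth hM.1 (by simp))

theorem exists_isMaxMatching (G : AssignmentGame U V) : ∃ M, G.IsMaxMatching M := by
  obtain ⟨M, hM, -, h⟩ := G.exists_matching_worth Finset.univ
  exact ⟨M, hM, fun M' hM' => h ▸ totalWeight_le_worth hM' (by simp)⟩

open Classical in
theorem IsMatching.sum_matched (hM : G.IsMatching M) (p : U ⊕ V → ℚ) :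
    ∑ q with IsMatchedIn M q, p q = ∑ e ∈ M, (p (.inl e.1) + p (.inr e.2)) := by
  have hset : (Finset.univ.filter fun q => IsMatchedIn M q) =
      M.image (fun e => (Sum.inl e.1 : U ⊕ V)) ∪ M.image fun e => Sum.inr e.2 := by
    ext q
    simp only [IsMatchedIn, Finset.mem_union, Finset.mem_image]
    grind
  rw [hset, Finset.sum_union, Finset.sum_image, Finset.sum_image, Finset.sum_add_distrib]
  · exact fun e he f hf h => hM.2 e he f hf (Or.inr (Sum.inr_injective h))
  · exact fun e he f hf h => hM.2 e he f hf (Or.inl (Sum.inl_injective h))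
  · rw [Finset.disjoint_left]
    intro q h1 h2
    obtain ⟨e, -, rfl⟩ := Finset.mem_image.1 h1
    obtain ⟨f, -, h⟩ := Finset.mem_image.1 h2
    cases h

theorem IsMatching.totalWeight_le_sum {S : Finset (U ⊕ V)} {p : U ⊕ V → ℚ} (hM : G.IsMatching M)
    (hS : ∀ e ∈ M, Sum.inl e.1 ∈ S ∧ Sum.inr e.2 ∈ S) (h0 : ∀ q, 0 ≤ p q)
    (hp : ∀ e ∈ G.edges, G.weight e ≤ p (.inl e.1) + p (.inr e.2)) :
    G.totalWeight M ≤ ∑ q ∈ S, p q := by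
  classical
  calc G.totalWeight M ≤ ∑ e ∈ M, (p (.inl e.1) + p (.inr e.2)) :=
        Finset.sum_le_sum fun e he => hp e (hM.1 he)
    _ = ∑ q with IsMatchedIn M q, p q := (hM.sum_matched p).symm
    _ ≤ ∑ q ∈ S, p q := by
        refine Finset.sum_le_sum_of_subset_of_nonneg ?_ fun q _ _ => h0 q
        intro q hq
        obtain ⟨e, he, rfl | rfl⟩ := (Finset.mem_filter.1 hq).2
        exacts [(hS e he).1, (hS e he).2]

theorem IsCoreImputation.weight_le {p : U ⊕ V → ℚ} (hp : G.IsCoreImputation p) {e : U × V}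
    (he : e ∈ G.edges) : G.weight e ≤ p (.inl e.1) + p (.inr e.2) := by
  classical
  have h1 : G.totalWeight {e} ≤ G.worth {.inl e.1, .inr e.2} :=
    totalWeight_le_worth ⟨by simpa using he, by simp⟩ (by simp)
  have h2 := hp.2 {.inl e.1, .inr e.2}
  rw [Finset.sum_pair (by simp)] at h2
  simpa [totalWeight] using h1.trans h2

/-- Complementary slackness with respect to a maximum weight matching. -/
theorem isCoreImputation_iff (hM : G.IsMaxMatching M) {p : U ⊕ V → ℚ} :
    G.IsCoreImputation p ↔ (∀ q, 0 ≤ p q) ∧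
      (∀ e ∈ G.edges, G.weight e ≤ p (.inl e.1) + p (.inr e.2)) ∧
      (∀ e ∈ M, p (.inl e.1) + p (.inr e.2) = G.weight e) ∧
      ∀ q, ¬ IsMatchedIn M q → p q = 0 := by
  classical
  have hsum : ∑ q, p q = ∑ e ∈ M, (p (.inl e.1) + p (.inr e.2)) +
      ∑ q with ¬ IsMatchedIn M q, p q := by
    rw [← hM.1.sum_matched p, Finset.sum_filter_add_sum_filter_not]
  constructor
  · intro hp
    have hw : ∀ e ∈ M, G.weight e ≤ p (.inl e.1) + p (.inr e.2) :=
      fun e he => hp.weight_le (hM.1.1 he)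
    have h1 := Finset.sum_le_sum hw
    have h2 : 0 ≤ ∑ q with ¬ IsMatchedIn M q, p q := Finset.sum_nonneg fun q _ => hp.1.1 q
    have h3 : ∑ q, p q = ∑ e ∈ M, G.weight e := hp.1.2.trans hM.worth_univ
    refine ⟨hp.1.1, fun e he => hp.weight_le he, fun e he => ?_, fun q hq => ?_⟩
    · exact ((Finset.sum_eq_sum_iff_of_le hw).1 (by linarith) e he).symm
    · exact (Finset.sum_eq_zero_iff_of_nonneg fun q _ => hp.1.1 q).1
        (by linarith : ∑ q with ¬ IsMatchedIn M q, p q = 0) q (by simpa using hq)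
  · rintro ⟨h0, hw, ht, hz⟩
    refine ⟨⟨h0, ?_⟩, fun S => ?_⟩
    · rw [hsum, hM.worth_univ, Finset.sum_congr rfl ht,
        Finset.sum_eq_zero fun q hq => hz q (Finset.mem_filter.1 hq).2, add_zero, totalWeight]
    · obtain ⟨M', hM', hS, h⟩ := G.exists_matching_worth S
      exact h ▸ hM'.totalWeight_le_sum hS h0 hw

/-- Guarantees that an agent whose profit is to be improved is counted in `sortedProfits`. -/
theorem IsCoreImputation.isEssential {p : U ⊕ V → ℚ} (hp : G.IsCoreImputation p) {q : U ⊕ V}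
    (hq : p q ≠ 0) : G.IsEssential q := fun _ hM =>
  not_not.1 fun h => hq (((isCoreImputation_iff hM).1 hp).2.2.2 q h)

/-- The profits of a core imputation can be chosen integral when the weights are. -/
theorem exists_int_isCoreImputation (hint : ∀ e ∈ G.edges, ∃ k : ℤ, G.weight e = k) :
    ∃ k : U ⊕ V → ℤ, G.IsCoreImputation fun q => (k q : ℚ) := by
  classical
  -- The bipartite graph is padded with zeros to a square matrix indexed by all agents on both
  -- sides.
  let w : U ⊕ V → U ⊕ V → ℤ := fun a b => match a, b with
    | .inl i, .inr j => if (i, j) ∈ G.edges then ⌊G.weight (i, j)⌋ else 0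
    | _, _ => 0
  have hwt : ∀ i j, (i, j) ∈ G.edges → (w (.inl i) (.inr j) : ℚ) = G.weight (i, j) := by
    intro i j h
    obtain ⟨k, hk⟩ := hint _ h
    simp [w, h, hk]
  have hw0 : ∀ a b, 0 ≤ w a b := by
    rintro (i | i) (j | j) <;> simp only [w, le_refl]
    split_ifs with h
    · exact Int.floor_nonneg.2 (G.weight_pos _ h).le
    · exact le_rfl
  obtain ⟨u, v, σ, hu, hv, huv, hσ⟩ := exists_perm_add_eq w hw0
  let k : U ⊕ V → ℤ := Sum.elim (fun i => u (.inl i)) fun j => v (.inr j)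
  have hk0 : ∀ q, (0 : ℚ) ≤ k q := by
    rintro (i | j)
    · exact_mod_cast hu _
    · exact_mod_cast hv _
  have hkw : ∀ e ∈ G.edges, G.weight e ≤ (k (.inl e.1) : ℚ) + k (.inr e.2) := by
    rintro ⟨i, j⟩ he
    rw [← hwt i j he]
    exact_mod_cast huv (.inl i) (.inr j)
  let M := G.edges.filter fun e => σ (.inl e.1) = .inr e.2
  have hM : G.IsMatching M := by
    refine ⟨Finset.filter_subset _ _, fun e he f hf h => ?_⟩
    have he := (Finset.mem_filter.1 he).2
    have hf := (Finset.mem_filter.1 hf).2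
    rcases h with h | h
    · exact Prod.ext h (Sum.inr_injective (he.symm.trans ((by rw [h] : _ = _).trans hf)))
    · refine Prod.ext (Sum.inl_injective (σ.injective ?_)) h
      rw [he, hf, h]
  have hMw : G.totalWeight M = ∑ a, (w a (σ a) : ℚ) := by
    rw [Fintype.sum_sum_type]
    have h2 : ∑ j : V, (w (.inr j) (σ (.inr j)) : ℚ) = 0 := by simp [w]
    rw [h2, add_zero, totalWeight]
    have hfib : ∀ i : U, (w (.inl i) (σ (.inl i)) : ℚ) =
        ∑ e ∈ M with e.1 = i, G.weight e := by
      intro i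
      rcases h : σ (.inl i) with i' | j
      · rw [Finset.sum_eq_zero]
        · simp [w]
        · rintro ⟨i₁, j₁⟩ he
          simp only [M, Finset.mem_filter] at he
          obtain ⟨⟨-, he⟩, rfl⟩ := he
          rw [h] at he
          cases he
      · by_cases hij : (i, j) ∈ G.edges
        · rw [Finset.sum_eq_single (i, j), hwt i j hij]
          · rintro ⟨i₁, j₁⟩ he hne
            simp only [M, Finset.mem_filter] at he
            obtain ⟨⟨-, he⟩, rfl⟩ := he
            rw [h] at he
            exact absurd (by rw [Sum.inr_injective he]) hne
          · intro hn
            exact absurd (by simp [M, hij, h]) hn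
        · rw [Finset.sum_eq_zero]
          · simp [w, hij]
          · rintro ⟨i₁, j₁⟩ he
            simp only [M, Finset.mem_filter] at he
            obtain ⟨⟨hin, he⟩, rfl⟩ := he
            rw [h] at he
            exact absurd (Sum.inr_injective he ▸ hin) hij
    simp only [hfib]
    exact (Finset.sum_fiberwise M (fun e => e.1) G.weight).symm
  -- The potentials of the padding rows and columns, dropped in `k`, are nonnegative.
  have hkM : ∑ q, (k q : ℚ) ≤ G.totalWeight M := by
    have h1 : ∑ a, (w a (σ a) : ℚ) = ∑ a, (u a : ℚ) + ∑ a, (v a : ℚ) := by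
      rw [← Equiv.sum_comp σ fun a => (v a : ℚ), ← Finset.sum_add_distrib]
      exact Finset.sum_congr rfl fun a _ => by exact_mod_cast (hσ a).symm
    rw [hMw, h1, Fintype.sum_sum_type, Fintype.sum_sum_type, Fintype.sum_sum_type]
    have h3 : (0 : ℚ) ≤ ∑ j : V, (u (.inr j) : ℚ) :=
      Finset.sum_nonneg fun j _ => by exact_mod_cast hu _
    have h4 : (0 : ℚ) ≤ ∑ i : U, (v (.inl i) : ℚ) :=
      Finset.sum_nonneg fun i _ => by exact_mod_cast hv _
    simp only [k, Sum.elim_inl, Sum.elim_inr]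
    linarith
  have hle : ∀ S : Finset (U ⊕ V), G.worth S ≤ ∑ q ∈ S, (k q : ℚ) := by
    intro S
    obtain ⟨M', hM', hS, h⟩ := G.exists_matching_worth S
    exact h ▸ hM'.totalWeight_le_sum (p := fun q => (k q : ℚ)) hS hk0 hkw
  exact ⟨k, ⟨hk0, le_antisymm (hkM.trans (totalWeight_le_worth hM (by simp))) (hle _)⟩, hle⟩

end AssignmentGame

/-! ### Shifting a residue class -/

namespace AssignmentGame

variable {U V : Type*} {G : AssignmentGame U V}

/-- Moves the profits in the residue class of `m` modulo `N` up by one on one side of the graph,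
those in the class of `-m` down by one on the other side (`s` tells the side of a vertex). -/
def shiftClass (N m : ℤ) (s : U ⊕ V → Bool) (k : U ⊕ V → ℤ) (q : U ⊕ V) : ℤ :=
  if s q then (if N ∣ k q - m then k q + 1 else k q) else (if N ∣ k q + m then k q - 1 else k q)

theorem dvd_sub_iff_of_add {N k l m W : ℤ} (hW : N ∣ W) (h : k + l = W) :
    N ∣ k - m ↔ N ∣ l + m := by
  have h' : k - m = W - (l + m) := by linarith
  rw [h', dvd_sub_right hW]

/-- If the sum equals `W`, the two classes are opposite and the moves cancel. Otherwise the slack is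
at least one, and only one endpoint can go down, by one. -/
theorem le_shiftClass_add {N m W : ℤ} {s : U ⊕ V → Bool} {k : U ⊕ V → ℤ} {a b : U ⊕ V}
    (hW : N ∣ W) (hs : s a ≠ s b) (h : W ≤ k a + k b) :
    W ≤ shiftClass N m s k a + shiftClass N m s k b := by
  have h1 := dvd_sub_iff_of_add (k := k a) (l := k b) (m := m) hW
  have h2 := dvd_sub_iff_of_add (k := k b) (l := k a) (m := m) hW
  unfold shiftClass
  rcases ha : s a <;> rcases hb : s b <;> simp_all <;> grind

theorem shiftClass_add_eq {N m W : ℤ} {s : U ⊕ V → Bool} {k : U ⊕ V → ℤ} {a b : U ⊕ V}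
    (hW : N ∣ W) (hs : s a ≠ s b) (h : k a + k b = W) :
    shiftClass N m s k a + shiftClass N m s k b = W := by
  have h1 := dvd_sub_iff_of_add (k := k a) (l := k b) (m := m) hW
  have h2 := dvd_sub_iff_of_add (k := k b) (l := k a) (m := m) hW
  unfold shiftClass
  rcases ha : s a <;> rcases hb : s b <;> simp_all <;> grind

/-- Half-integral profits do not move; in particular the zero profits of unmatched agents survive.
-/
theorem shiftClass_of_dvd {N m : ℤ} {s : U ⊕ V → Bool} {k : U ⊕ V → ℤ} {q : U ⊕ V}
    (hm : ¬ N ∣ 2 * m) (hq : N ∣ 2 * k q) : shiftClass N m s k q = k q := by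
  unfold shiftClass
  have h1 : ¬ N ∣ k q - m := fun h => hm (by
    rw [show 2 * m = 2 * k q - 2 * (k q - m) by ring]; exact dvd_sub hq (h.mul_left 2))
  have h2 : ¬ N ∣ k q + m := fun h => hm (by
    rw [show 2 * m = 2 * (k q + m) - 2 * k q by ring]; exact dvd_sub (h.mul_left 2) hq)
  simp [h1, h2]

variable [Fintype U] [Fintype V]

theorem isCoreImputation_shiftClass (hint : ∀ e ∈ G.edges, ∃ k : ℤ, G.weight e = k)
    {N m : ℤ} (hN : 0 < N) (hm : ¬ N ∣ 2 * m) {s : U ⊕ V → Bool}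
    (hs : ∀ i j, s (.inl i) ≠ s (.inr j)) {k : U ⊕ V → ℤ}
    (hk : G.IsCoreImputation fun q => (k q : ℚ) / N) :
    G.IsCoreImputation fun q => (shiftClass N m s k q : ℚ) / N := by
  obtain ⟨M, hM⟩ := G.exists_isMaxMatching
  have hN' : (0 : ℚ) < N := by exact_mod_cast hN
  rw [isCoreImputation_iff hM] at hk ⊢
  obtain ⟨h0, hw, ht, hz⟩ := hk
  have hzero : ∀ q, k q = 0 → shiftClass N m s k q = 0 := fun q hq => by
    rw [shiftClass_of_dvd hm (by simp [hq]), hq]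
  refine ⟨fun q => ?_, fun e he => ?_, fun e he => ?_, fun q hq => ?_⟩
  · have h : (0 : ℚ) ≤ k q := by simpa [div_nonneg_iff, hN'.le, hN'.not_ge] using h0 q
    refine div_nonneg ?_ hN'.le
    norm_cast at h ⊢
    rcases h.eq_or_lt with h | h
    · exact (hzero q h.symm).ge
    · unfold shiftClass
      split_ifs <;> omega
  · obtain ⟨W, hW⟩ := hint e he
    have h := hw e he
    rw [hW, ← add_div, le_div_iff₀ hN'] at h ⊢
    norm_cast at h ⊢
    exact le_shiftClass_add (dvd_mul_left N W) (hs _ _) h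
  · obtain ⟨W, hW⟩ := hint e (hM.1.1 he)
    have h := ht e he
    rw [hW, ← add_div, div_eq_iff hN'.ne'] at h ⊢
    norm_cast at h ⊢
    exact shiftClass_add_eq (dvd_mul_left N W) (hs _ _) h
  · have h := hz q hq
    rw [div_eq_zero_iff, or_iff_left hN'.ne'] at h
    rw [hzero q (by exact_mod_cast h)]
    simp

/-- A core imputation with profits in `(1/N)ℤ`, `N` even, that is not half-integral is beaten by
another one with profits in `(1/N)ℤ`. -/
theorem exists_sortedProfits_lt (hint : ∀ e ∈ G.edges, ∃ k : ℤ, G.weight e = k)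
    {N : ℤ} (hN : 0 < N) (hN2 : Even N) {k : U ⊕ V → ℤ}
    (hk : G.IsCoreImputation fun q => (k q : ℚ) / N) (hq : ∃ q, ¬ N ∣ 2 * k q) :
    ∃ k' : U ⊕ V → ℤ, G.IsCoreImputation (fun q => (k' q : ℚ) / N) ∧
      G.sortedProfits (fun q => (k q : ℚ) / N) < G.sortedProfits fun q => (k' q : ℚ) / N := by
  classical
  have hN' : (0 : ℚ) < N := by exact_mod_cast hN
  obtain ⟨q₀, hq₀, hmin⟩ := Finset.exists_min_image (Finset.univ.filter fun q => ¬ N ∣ 2 * k q) k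
    (by obtain ⟨q, hq⟩ := hq; exact ⟨q, by simpa using hq⟩)
  replace hq₀ : ¬ N ∣ 2 * k q₀ := by simpa using hq₀
  let s : U ⊕ V → Bool := fun q => q.isLeft == q₀.isLeft
  have hsq : s q₀ = true := by simp [s]
  refine ⟨shiftClass N (k q₀) s k,
    isCoreImputation_shiftClass hint hN hq₀ (fun i j => by cases q₀ <;> simp [s]) hk, ?_⟩
  refine Finset.sort_map_lt _ _ _ ((k q₀ : ℚ) / N) (fun a _ ha => ?_) ⟨q₀, ?_, le_rfl, ?_⟩
  · have ha : shiftClass N (k q₀) s k a ≤ k q₀ := by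
      rw [div_le_div_iff_of_pos_right hN'] at ha
      exact_mod_cast ha
    suffices h : shiftClass N (k q₀) s k a = k a by rw [h]
    by_contra hne
    have hd : ¬ N ∣ 2 * k a := fun h => hne (shiftClass_of_dvd hq₀ h)
    have hle := hmin a (by simpa using hd)
    have hcases : shiftClass N (k q₀) s k a = k a ∨ shiftClass N (k q₀) s k a = k a + 1 ∨
        shiftClass N (k q₀) s k a = k a - 1 ∧ N ∣ k a + k q₀ := by
      unfold shiftClass
      split_ifs <;> simp [*]
    rcases hcases with h | h | ⟨h, h2⟩
    · exact hne h
    · omega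
    -- A lowered agent ending at or below `k q₀` would start at `k q₀` or `k q₀ + 1`. The first
    -- gives `N ∣ 2 * k q₀`, the second makes the odd number `2 * k q₀ + 1` a multiple of the even
    -- `N`.
    · obtain ⟨c, rfl⟩ := hN2
      obtain ⟨d, hd'⟩ := h2
      rcases (by omega : k a = k q₀ ∨ k a = k q₀ + 1) with h3 | h3
      · exact hq₀ ⟨d, by rw [← hd', h3]; ring⟩
      · have : k q₀ + 1 + k q₀ = 2 * (c * d) := by rw [← h3, hd']; ring
        omega
  · refine Finset.mem_filter.2 ⟨Finset.mem_univ _, hk.isEssential ?_⟩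
    have : k q₀ ≠ 0 := fun h => hq₀ (by simp [h])
    exact div_ne_zero (by exact_mod_cast this) hN'.ne'
  · rw [div_lt_div_iff_of_pos_right hN']
    norm_cast
    simp [shiftClass, hsq]

/-! ### Half-integrality and existence -/

theorem exists_half_of_maximal (hint : ∀ e ∈ G.edges, ∃ k : ℤ, G.weight e = k)
    {N : ℤ} (hN : 0 < N) (hN2 : Even N) {k : U ⊕ V → ℤ}
    (hk : G.IsCoreImputation fun q => (k q : ℚ) / N)
    (hmax : ∀ k' : U ⊕ V → ℤ, G.IsCoreImputation (fun q => (k' q : ℚ) / N) →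
      G.sortedProfits (fun q => (k' q : ℚ) / N) ≤ G.sortedProfits fun q => (k q : ℚ) / N) :
    ∃ l : U ⊕ V → ℤ, ∀ q, (k q : ℚ) / N = (l q : ℚ) / 2 := by
  have hdvd : ∀ q, N ∣ 2 * k q := by
    by_contra! h
    obtain ⟨k', hk', hlt⟩ := exists_sortedProfits_lt hint hN hN2 hk h
    exact absurd hlt (not_lt.2 (hmax k' hk'))
  choose l hl using hdvd
  refine ⟨l, fun q => ?_⟩
  have hN' : (N : ℚ) ≠ 0 := by exact_mod_cast hN.ne'
  rw [div_eq_div_iff hN' two_ne_zero]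
  have := hl q
  have h : (2 * k q : ℚ) = N * l q := by exact_mod_cast this
  linarith

/-- Among the core imputations with profits in `(1/N)ℤ` some are lexicographically largest. -/
theorem exists_maximal_of_denominator (hint : ∀ e ∈ G.edges, ∃ k : ℤ, G.weight e = k)
    {N : ℤ} (hN : 0 < N) :
    ∃ k : U ⊕ V → ℤ, G.IsCoreImputation (fun q => (k q : ℚ) / N) ∧
      ∀ k' : U ⊕ V → ℤ, G.IsCoreImputation (fun q => (k' q : ℚ) / N) →
        G.sortedProfits (fun q => (k' q : ℚ) / N) ≤ G.sortedProfits fun q => (k q : ℚ) / N := by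
  classical
  have hN' : (0 : ℚ) < N := by exact_mod_cast hN
  let A : Set (U ⊕ V → ℤ) := {k | G.IsCoreImputation fun q => (k q : ℚ) / N}
  have hfin : A.Finite := by
    refine (Set.finite_Icc (0 : U ⊕ V → ℤ) fun _ => ⌊G.worth Finset.univ * N⌋).subset ?_
    intro k hk
    refine ⟨fun q => ?_, fun q => Int.le_floor.2 ?_⟩
    · have := hk.1.1 q
      rw [le_div_iff₀ hN', zero_mul] at this
      exact_mod_cast this
    · rw [← div_le_iff₀ hN', ← hk.1.2]
      exact Finset.single_le_sum (f := fun q => (k q : ℚ) / N) (fun q _ => hk.1.1 q)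
        (Finset.mem_univ q)
  have hne : A.Nonempty := by
    obtain ⟨k, hk⟩ := exists_int_isCoreImputation hint
    refine ⟨fun q => k q * N, ?_⟩
    simpa [A, mul_div_cancel_right₀ _ hN'.ne'] using hk
  exact A.exists_max_image (fun k => G.sortedProfits fun q => (k q : ℚ) / N) hfin hne

theorem exists_even_denominator {α : Type*} [Fintype α] (p : α → ℚ) :
    ∃ N : ℤ, 0 < N ∧ Even N ∧ ∃ k : α → ℤ, ∀ q, p q = (k q : ℚ) / N := by
  classical
  let D : ℕ := ∏ q, (p q).den
  have hD : 0 < D := Finset.prod_pos fun q _ => (p q).den_pos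
  have hdvd : ∀ q, (p q).den ∣ D := fun q => Finset.dvd_prod_of_mem _ (Finset.mem_univ q)
  choose c hc using hdvd
  refine ⟨2 * D, by positivity, even_two_mul _, fun q => 2 * c q * (p q).num, fun q => ?_⟩
  have hD' : (D : ℚ) ≠ 0 := by exact_mod_cast hD.ne'
  have h1 : (D : ℚ) = (p q).den * c q := by exact_mod_cast hc q
  have h2 := Rat.mul_den_eq_num (p q)
  push_cast
  rw [eq_div_iff (by positivity), h1, ← h2]
  ring

theorem exists_half_sortedProfits_ge (hint : ∀ e ∈ G.edges, ∃ k : ℤ, G.weight e = k)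
    {p : U ⊕ V → ℚ} (hp : G.IsCoreImputation p) :
    ∃ l : U ⊕ V → ℤ, G.IsCoreImputation (fun q => (l q : ℚ) / (2 : ℤ)) ∧
      G.sortedProfits p ≤ G.sortedProfits fun q => (l q : ℚ) / (2 : ℤ) := by
  obtain ⟨N, hN, hN2, k, hk⟩ := exists_even_denominator p
  obtain rfl : p = fun q => (k q : ℚ) / N := funext hk
  obtain ⟨k', hk', hmax⟩ := exists_maximal_of_denominator hint hN
  obtain ⟨l, hl⟩ := exists_half_of_maximal hint hN hN2 hk' hmax
  have hfun : (fun q => (k' q : ℚ) / N) = fun q => (l q : ℚ) / (2 : ℤ) :=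
    funext fun q => by simpa using hl q
  exact ⟨l, hfun ▸ hk', hfun ▸ hmax k hp⟩

theorem exists_isLeximin (hint : ∀ e ∈ G.edges, ∃ k : ℤ, G.weight e = k) :
    ∃ p, G.IsLeximin p := by
  obtain ⟨k, hk, hmax⟩ := exists_maximal_of_denominator hint two_pos
  refine ⟨_, hk, fun p hp => ?_⟩
  obtain ⟨l, hl, hle⟩ := exists_half_sortedProfits_ge hint hp
  exact hle.trans (hmax l hl)

theorem IsLeximin.exists_half (hint : ∀ e ∈ G.edges, ∃ k : ℤ, G.weight e = k)
    {p : U ⊕ V → ℚ} (hp : G.IsLeximin p) (q : U ⊕ V) : ∃ k : ℤ, p q = (k : ℚ) / 2 := by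
  obtain ⟨N, hN, hN2, k, hk⟩ := exists_even_denominator p
  obtain rfl : p = fun q => (k q : ℚ) / N := funext hk
  obtain ⟨l, hl⟩ := exists_half_of_maximal hint hN hN2 hp.1 fun k' hk' => hp.2 _ hk'
  exact ⟨l q, hl q⟩

theorem IsCoreImputation.average {p p' : U ⊕ V → ℚ} (hp : G.IsCoreImputation p)
    (hp' : G.IsCoreImputation p') : G.IsCoreImputation fun q => (p q + p' q) / 2 := by
  have hsum : ∀ S : Finset (U ⊕ V),
      ∑ q ∈ S, (p q + p' q) / 2 = (∑ q ∈ S, p q + ∑ q ∈ S, p' q) / 2 := fun S => by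
    rw [← Finset.sum_div, Finset.sum_add_distrib]
  refine ⟨⟨fun q => ?_, ?_⟩, fun S => ?_⟩
  · have h1 := hp.1.1 q
    have h2 := hp'.1.1 q
    positivity
  · rw [hsum, hp.1.2, hp'.1.2]
    ring
  · rw [hsum]
    linarith [hp.2 S, hp'.2 S]

theorem IsLeximin.eq {p p' : U ⊕ V → ℚ} (hp : G.IsLeximin p) (hp' : G.IsLeximin p') :
    p = p' := by
  classical
  by_contra hne
  obtain ⟨q, hq⟩ := Function.ne_iff.1 hne
  obtain ⟨q₀, hq₀, hmin⟩ := Finset.exists_min_image (Finset.univ.filter fun q => p q ≠ p' q)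
    (fun q => min (p q) (p' q)) ⟨q, by simpa using hq⟩
  replace hq₀ : p q₀ ≠ p' q₀ := by simpa using hq₀
  wlog hlt : p q₀ < p' q₀ generalizing p p'
  · refine this hp' hp (Ne.symm hne) hq.symm ?_ hq₀.symm (hq₀.lt_or_gt.resolve_left hlt)
    intro q hq
    rw [min_comm, min_comm (p' q)]
    exact hmin q (by simpa [eq_comm] using hq)
  refine absurd (hp.2 _ (hp.1.average hp'.1)) (not_le.2 ?_)
  refine Finset.sort_map_lt _ _ _ (p q₀) (fun a _ ha => ?_) ⟨q₀, ?_, le_rfl, by linarith⟩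
  · by_cases h : p a = p' a
    · rw [← h]
      ring
    · have h1 := hmin a (by simpa using h)
      simp only [min_eq_left hlt.le, le_min_iff] at h1
      exact absurd (by linarith : p a = p' a) h
  · refine Finset.mem_filter.2 ⟨Finset.mem_univ _, hp'.1.isEssential ?_⟩
    exact ((hp.1.1.1 q₀).trans_lt hlt).ne'

end AssignmentGame

theorem mainTheorem6 {U V : Type*} [Fintype U] [Fintype V] (G : AssignmentGame U V)
    (hint : ∀ e ∈ G.edges, ∃ k : ℤ, G.weight e = k) :
    (∃! p : U ⊕ V → ℚ, G.IsLeximin p) ∧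
      ∀ p : U ⊕ V → ℚ, G.IsLeximin p → ∀ q, ∃ k : ℤ, p q = (k : ℚ) / 2 := by
  obtain ⟨p, hp⟩ := AssignmentGame.exists_isLeximin hint
  exact ⟨⟨p, hp, fun p' hp' => hp'.eq hp⟩, fun p hp q => hp.exists_half hint q⟩
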